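/- Let $G$ be a topological group. A $G$-flow is a compact Hausdorff space $X$ with a (jointly) continuous action $G\times X\to X$. An irreducible extension of a $G$-flow $X$ is a continuous, $G$-equivariant, surjective map $\pi\colon Y\to X$, where $Y$ is a $G$-flow, such that every non-empty open set $U\subseteq Y$ contains the fiber $\pi^{-1}(\{x\})$ of some $x\in X$. A $G$-flow $X$ is called Gleason complete if it has no non-trivial irreducible extension, i.e. every irreducible extension $\pi\colon Y\to X$ is an isomorphism of $G$-flows (an equivariant homeomorphism). Let $\mathrm{Sub}(G)$ be the set of closed subgroups of $G$ with the Chabauty topology, i.e. the topology with the subbasis of all sets $\{H : H\cap K=\emptyset\}$ with $K\subseteq G$ compact and $\{H : H\cap U\neq\emptyset\}$ with $U\subseteq G$ open. Theorem 4.1. Let $G$ be a locally compact group and let $X$ be a Gleason complete $G$-flow. Then the stabilizer map $X\to\mathrm{Sub}(G)$, $x\mapsto G_x=\{g\in G : g\cdot x=x\}$, is continuous. -/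

import Mathlib

open Set TopologicalSpace

universe u v w

/-! A `G`-flow is a compact Hausdorff space `X` with a (jointly) continuous action of the topological
group `G`, that is `[CompactSpace X] [T2Space X] [MulAction G X] [ContinuousSMul G X]`. -/

/-- A map `π : Y → X` is irreducible if every non-empty open subset of `Y` contains a whole fiber
`π ⁻¹' {x}` of some point `x` of `X`. -/
def IsIrreducibleMap {Y : Type v} {X : Type w} [TopologicalSpace Y] (π : Y → X) : Prop :=
  ∀ U : Set Y, IsOpen U → U.Nonempty → ∃ x : X, π ⁻¹' {x} ⊆ U

/-- An irreducible extension `π : Y → X` of `G`-flows: a continuous, `G`-equivariant, surjective map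
which is irreducible as a map between topological spaces. -/
structure IsIrreducibleExtension (G : Type u) [Group G] {Y : Type v} {X : Type w}
    [TopologicalSpace Y] [MulAction G Y] [TopologicalSpace X] [MulAction G X] (π : Y → X) :
    Prop where
  continuous : Continuous π
  map_smul : ∀ (g : G) (y : Y), π (g • y) = g • π y
  surjective : Function.Surjective π
  irreducible : IsIrreducibleMap π

/-- A `G`-flow `X` is Gleason complete if it has no non-trivial irreducible extension: every
irreducible extension `π : Y → X` by a `G`-flow `Y` is an isomorphism of flows. Every irreducible
extension of `X` is a quotient of the Stone space of the regular open algebra of `X`,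
so it is enough to let `Y` range over the universe of `X`. -/
def IsGleasonComplete (G : Type u) [Group G] [TopologicalSpace G] (X : Type v)
    [TopologicalSpace X] [MulAction G X] : Prop :=
  ∀ (Y : Type v) [TopologicalSpace Y] [CompactSpace Y] [T2Space Y] [MulAction G Y]
    [ContinuousSMul G Y] (π : Y → X), IsIrreducibleExtension G π → IsHomeomorph π

/-- The Chabauty topology on the closed subsets of `Y`, with the subbasis of the sets
`{F | F ∩ K = ∅}` for `K` compact and `{F | F ∩ U ≠ ∅}` for `U` open. -/
@[reducible]
def chabautyTopology (Y : Type u) [TopologicalSpace Y] : TopologicalSpace (Closeds Y) :=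
  generateFrom
    ({S | ∃ K : Set Y, IsCompact K ∧ S = {F : Closeds Y | (F : Set Y) ∩ K = ∅}} ∪
      {S | ∃ U : Set Y, IsOpen U ∧ S = {F : Closeds Y | ((F : Set Y) ∩ U).Nonempty}})

/-- The underlying closed set of a closed subgroup. -/
def ClosedSubgroup.toClosedSet {G : Type u} [Group G] [TopologicalSpace G]
    (H : ClosedSubgroup G) : Closeds G :=
  ⟨H.carrier, H.isClosed'⟩

/-- The space `Sub(G)` of closed subgroups of `G` carries the Chabauty topology, as a subspace of
the space of closed subsets of `G`. -/
instance ClosedSubgroup.instChabauty (G : Type u) [Group G] [TopologicalSpace G] :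
    TopologicalSpace (ClosedSubgroup G) :=
  (chabautyTopology G).induced ClosedSubgroup.toClosedSet

/-- The stabilizer map `x ↦ G_x` of a `G`-flow, with values in `Sub(G)`. -/
def stabilizerMap (G : Type u) [Group G] [TopologicalSpace G] (X : Type v) [TopologicalSpace X]
    [T2Space X] [MulAction G X] [ContinuousSMul G X] (x : X) : ClosedSubgroup G where
  toSubgroup := MulAction.stabilizer G x
  isClosed' := isClosed_eq (continuous_id.smul continuous_const) continuous_const

/-! Missing a compact set is an open condition on stabilizers in any Hausdorff flow; the content is
that every `g` fixing `x` is approximated by elements fixing the points near `x`. If this fails,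
then for some compact neighbourhood `A` of `g`, `x` is in the closure of the open set `W` of points
fixed by no element of `A`. By `exists_finite_coloring`, `W` lies in the closure of finitely many
thickenings `D • O i`, where `A` moves `O i` off itself. So `x = g • x` is in the closure of some `D
• O i` and of its `g`-translate. For small `D` these sets are uniformly separated, contradicting
`IsGleasonComplete.disjoint_closure`.

Completeness enters through that lemma. A bump function on `G` turns uniform separation into a lower
semicontinuous, `G`-continuous function equal to 1 and 0 on the two sets. Its limits form a
continuous function on the compact space of generic ultrafilters, which maps irreducibly onto `X`.
Remembering only the limit point and the values along the orbit gives a quotient that is a genuine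
flow, hence `X` itself, so the limit depends only on the point of `X`. -/

open Filter Topology Pointwise

/-! ### Flow quotients of irreducible extensions -/

section Quotient

variable {G : Type u} [Group G] {X : Type v} {Z : Type v} [MulAction G Z]

/-- Two points are identified if they have the same image under `π` and if `f` agrees along their
orbits. -/
def orbitSetoid (G : Type u) [Group G] [MulAction G Z] (π : Z → X) (f : Z → ℝ) : Setoid Z :=
  Setoid.ker fun z => (π z, fun g : G => f (g • z))

theorem orbitSetoid_iff {π : Z → X} {f : Z → ℝ} {z z' : Z} :
    (orbitSetoid G π f) z z' ↔ π z = π z' ∧ ∀ g : G, f (g • z) = f (g • z') :=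
  Prod.mk_inj.trans (and_congr_right' funext_iff)

/-- A function `f` on an irreducible extension `Z` of a Gleason complete flow `X` which is continuous
and `G`-continuous factors through `X`; here `G` acts on `Z` by homeomorphisms, but neither joint
continuity nor Hausdorffness is assumed. -/
theorem IsGleasonComplete.eq_of_map_eq [TopologicalSpace G] [IsTopologicalGroup G]
    [TopologicalSpace X] [MulAction G X] [CompactSpace X] [T2Space X] [ContinuousSMul G X]
    (hX : IsGleasonComplete G X) [TopologicalSpace Z] [CompactSpace Z] [ContinuousConstSMul G Z]
    {π : Z → X} (hπ : IsIrreducibleExtension G π) {f : Z → ℝ} (hf : Continuous f)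
    (hfG : ∀ ε > 0, ∀ᶠ g in 𝓝 (1 : G), ∀ z, |f (g • z) - f z| ≤ ε)
    {z z' : Z} (hz : π z = π z') : f z = f z' := by
  let r := orbitSetoid G π f
  let Y := Quotient r
  let q : Z → Y := Quotient.mk r
  have hq : Continuous q := continuous_quotient_mk'
  let e : Y → X × (G → ℝ) :=
    Quotient.lift (fun z => (π z, fun g : G => f (g • z))) fun _ _ h => h
  have he : Continuous e := by
    refine Continuous.quotient_lift ?_ _
    exact hπ.continuous.prodMk (continuous_pi fun g => hf.comp (continuous_const_smul g))
  have hinj : Function.Injective e := by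
    intro a b
    induction a using Quotient.inductionOn
    induction b using Quotient.inductionOn
    exact fun h => Quotient.sound h
  have : T2Space Y := T2Space.of_injective_continuous hinj he
  have hemb := he.isClosedEmbedding hinj
  let : MulAction G Y :=
    { smul := fun g => Quotient.map (fun z => g • z) (by
        intro a b hab
        have h := orbitSetoid_iff.1 hab
        refine orbitSetoid_iff.2 ⟨?_, fun k => ?_⟩
        · rw [hπ.map_smul, hπ.map_smul, h.1]
        · rw [smul_smul, smul_smul, h.2])
      one_smul := fun a => by
        induction a using Quotient.inductionOn
        exact congrArg q (one_smul _ _)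
      mul_smul := fun g k a => by
        induction a using Quotient.inductionOn
        exact congrArg q (mul_smul _ _ _) }
  have hsmul : ∀ (g : G) (z : Z), g • q z = q (g • z) := fun _ _ => rfl
  let ρ : Y → X := fun y => (e y).1
  have hρ : Continuous ρ := continuous_fst.comp he
  have hρs : ∀ (g : G) (y : Y), ρ (g • y) = g • ρ y := by
    intro g y
    induction y using Quotient.inductionOn
    exact hπ.map_smul _ _
  let F : Y → ℝ := fun y => (e y).2 1
  have hFq : ∀ z, F (q z) = f z := fun z => congrArg f (one_smul G z)
  have heF : ∀ (y : Y) (g : G), (e y).2 g = F (g • y) := by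
    intro y g
    induction y using Quotient.inductionOn with | _ z
    rw [show (⟦z⟧ : Y) = q z from rfl, hsmul, hFq]
    rfl
  have hFG : ∀ ε > 0, ∀ᶠ g in 𝓝 (1 : G), ∀ y, |F (g • y) - F y| ≤ ε := by
    intro ε hε
    filter_upwards [hfG ε hε] with g hg y
    induction y using Quotient.inductionOn with | _ z
    rw [show (⟦z⟧ : Y) = q z from rfl, hsmul, hFq, hFq]
    exact hg z
  have hFg : ∀ g : G, Continuous fun y : Y => F (g • y) := by
    intro g
    simp only [← heF]
    exact (continuous_apply g).comp (continuous_snd.comp he)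
  have : ContinuousSMul G Y := by
    refine ⟨hemb.isInducing.continuous_iff.2 ?_⟩
    refine Continuous.prodMk (f := fun p : G × Y => (e (p.1 • p.2)).1) ?_ ?_
    · change Continuous fun p : G × Y => ρ (p.1 • p.2)
      simp only [hρs]
      exact continuous_fst.smul (hρ.comp continuous_snd)
    · refine continuous_pi fun k => ?_
      change Continuous fun p : G × Y => (e (p.1 • p.2)).2 k
      simp only [heF]
      refine continuous_iff_continuousAt.2 fun ⟨g₀, y₀⟩ => ?_
      refine Metric.tendsto_nhds.2 fun ε hε => ?_
      -- Write `k * g = (k * g * g₀⁻¹ * k⁻¹) * (k * g₀)`: the first factor tends to 1, and its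
      -- effect on `F` is uniform in the point.
      have h1 : ∀ᶠ p : G × Y in 𝓝 (g₀, y₀),
          ∀ y, |F ((k * p.1 * g₀⁻¹ * k⁻¹) • y) - F y| ≤ ε / 2 := by
        have : Tendsto (fun p : G × Y => k * p.1 * g₀⁻¹ * k⁻¹) (𝓝 (g₀, y₀)) (𝓝 1) := by
          have hc : Continuous fun p : G × Y => k * p.1 * g₀⁻¹ * k⁻¹ := by fun_prop
          have := hc.tendsto (g₀, y₀)
          simpa using this
        exact this.eventually (hFG (ε / 2) (by positivity))
      have h2 : ∀ᶠ p : G × Y in 𝓝 (g₀, y₀),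
          dist (F ((k * g₀) • p.2)) (F ((k * g₀) • y₀)) < ε / 2 :=
        (((hFg (k * g₀)).comp continuous_snd).tendsto (g₀, y₀)).eventually
          (Metric.ball_mem_nhds _ (by positivity))
      filter_upwards [h1, h2] with p hp1 hp2
      have h3 := hp1 ((k * g₀) • p.2)
      rw [smul_smul, show k * p.1 * g₀⁻¹ * k⁻¹ * (k * g₀) = k * p.1 by group] at h3
      rw [← Real.dist_eq] at h3
      rw [smul_smul, smul_smul]
      exact (dist_triangle _ _ _).trans_lt (by linarith)
  have hext : IsIrreducibleExtension G ρ :=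
    { continuous := hρ
      map_smul := hρs
      surjective := fun x => (hπ.surjective x).imp' q fun _ h => h
      irreducible := by
        intro U hU hne
        obtain ⟨y, hy⟩ := hne
        obtain ⟨z, rfl⟩ := Quotient.exists_rep y
        obtain ⟨x, hx⟩ := hπ.irreducible (q ⁻¹' U) (hU.preimage hq) ⟨z, hy⟩
        refine ⟨x, fun y hy => ?_⟩
        obtain ⟨z, rfl⟩ := Quotient.exists_rep y
        exact hx hy }
  have := (hX Y ρ hext).injective (a₁ := q z) (a₂ := q z') hz
  rw [← hFq, ← hFq, this]

end Quotient

/-! ### The space of generic ultrafilters -/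

/-- The ultrafilters on `X` that contain all dense open sets. -/
def GenericUltrafilter (X : Type v) [TopologicalSpace X] : Type v :=
  {z : Ultrafilter X // ∀ U : Set X, IsOpen U → Dense U → U ∈ z}

namespace GenericUltrafilter

section Space

variable {X : Type v} [TopologicalSpace X]

/-- The basic sets are those of the generic ultrafilters containing a given open set of `X`. -/
instance : TopologicalSpace (GenericUltrafilter X) :=
  generateFrom {S | ∃ U : Set X, IsOpen U ∧ S = {z | U ∈ z.1}}

theorem isOpen_basic {U : Set X} (hU : IsOpen U) : IsOpen {z : GenericUltrafilter X | U ∈ z.1} :=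
  isOpen_generateFrom_of_mem ⟨U, hU, rfl⟩

theorem isTopologicalBasis :
    IsTopologicalBasis {S : Set (GenericUltrafilter X) | ∃ U : Set X, IsOpen U ∧ S = {z | U ∈ z.1}}
    where
  exists_subset_inter := by
    rintro _ ⟨U, hU, rfl⟩ _ ⟨V, hV, rfl⟩ z hz
    exact ⟨_, ⟨U ∩ V, hU.inter hV, rfl⟩, inter_mem hz.1 hz.2,
      fun w hw => ⟨mem_of_superset hw inter_subset_left, mem_of_superset hw inter_subset_right⟩⟩
  sUnion_eq := eq_univ_of_forall fun z => ⟨_, ⟨univ, isOpen_univ, rfl⟩, univ_mem⟩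
  eq_generateFrom := rfl

/-- The boundary of a closed set is nowhere dense, so generic ultrafilters ignore it. -/
theorem interior_mem {C : Set X} (hC : IsClosed C) {z : GenericUltrafilter X} (h : C ∈ z.1) :
    interior C ∈ z.1 := by
  have hd : Dense (interior C ∪ Cᶜ) := by
    rw [← closure_eq_iff_isClosed.2 hC, dense_iff_closure_eq, closure_union, eq_univ_iff_forall]
    intro x
    by_cases hx : x ∈ interior (closure C)
    · exact Or.inl (subset_closure hx)
    · right
      rwa [closure_compl]
  refine mem_of_superset (inter_mem h (z.2 _ (isOpen_interior.union hC.isOpen_compl) hd)) ?_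
  rintro x ⟨hx, h | h⟩
  · exact h
  · exact absurd hx h

/-- The generic ultrafilters are closed in the compact space of all ultrafilters, and the topology
used here is coarser than the induced one. -/
instance : CompactSpace (GenericUltrafilter X) := by
  have hclosed : IsClosed {z : Ultrafilter X | ∀ U : Set X, IsOpen U → Dense U → U ∈ z} := by
    simp only [ofPred_forall]
    exact isClosed_iInter fun U => isClosed_iInter fun _ => isClosed_iInter fun _ =>
      ultrafilter_isClosed_basic U
  have := isCompact_iff_compactSpace.1 hclosed.isCompact
  let i : {z : Ultrafilter X | ∀ U : Set X, IsOpen U → Dense U → U ∈ z} → GenericUltrafilter X := id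
  have hi : Continuous i := by
    refine continuous_generateFrom_iff.2 ?_
    rintro _ ⟨U, -, rfl⟩
    exact (ultrafilter_isOpen_basic U).preimage continuous_subtype_val
  exact (show Function.Surjective i from Function.surjective_id).compactSpace hi

/-- Finite intersections of dense open sets are dense, so the filter `D` they generate meets the
trace on `O` of every neighbourhood of `x`. -/
theorem exists_of_mem_closure {x : X} {O : Set X} (hO : IsOpen O) (hx : x ∈ closure O) :
    ∃ z : GenericUltrafilter X, (z.1 : Filter X) ≤ 𝓝 x ∧ O ∈ z.1 := by
  let D : Filter X :=
    { sets := {S | ∃ U ⊆ S, IsOpen U ∧ Dense U}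
      univ_sets := ⟨univ, subset_rfl, isOpen_univ, dense_univ⟩
      sets_of_superset := fun ⟨U, hU, h⟩ hST => ⟨U, hU.trans hST, h⟩
      inter_sets := fun ⟨U, hUS, hU, hUd⟩ ⟨V, hVT, hV, hVd⟩ =>
        ⟨U ∩ V, inter_subset_inter hUS hVT, hU.inter hV, hUd.inter_of_isOpen_left hVd hU⟩ }
  have hne : NeBot (𝓝 x ⊓ 𝓟 O ⊓ D) := by
    rw [inf_neBot_iff]
    rintro S hS T ⟨U, hUT, -, hUd⟩
    obtain ⟨N, hN, hNS⟩ := mem_inf_principal.1 hS |> mem_nhds_iff.1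
    obtain ⟨y, hy⟩ := mem_closure_iff.1 hx N hNS.1 hNS.2
    obtain ⟨w, hw, hwU⟩ := hUd.inter_open_nonempty (N ∩ O) (hNS.1.inter hO) ⟨y, hy⟩
    exact ⟨w, hN hw.1 hw.2, hUT hwU⟩
  have hle := Ultrafilter.of_le (𝓝 x ⊓ 𝓟 O ⊓ D)
  refine ⟨⟨Ultrafilter.of (𝓝 x ⊓ 𝓟 O ⊓ D), fun U hU hUd => ?_⟩, ?_, ?_⟩
  · exact hle (mem_inf_of_right ⟨U, subset_rfl, hU, hUd⟩)
  · exact hle.trans (inf_le_left.trans inf_le_left)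
  · exact hle (mem_inf_of_left (mem_inf_of_right (mem_principal_self O)))

/-- The limit of a bounded lower semicontinuous function along generic ultrafilters is
continuous. -/
theorem continuous_of_tendsto {F : X → ℝ} (hF : LowerSemicontinuous F)
    {f : GenericUltrafilter X → ℝ} (hf : ∀ z, Tendsto F z.1 (𝓝 (f z))) : Continuous f := by
  refine continuous_iff_continuousAt.2 fun z₀ => Metric.tendsto_nhds.2 fun ε hε => ?_
  have h1 : F ⁻¹' Ioi (f z₀ - ε / 2) ∈ z₀.1 :=
    (hf z₀).eventually (lt_mem_nhds (by linarith))
  have h2 : interior (F ⁻¹' Iic (f z₀ + ε / 2)) ∈ z₀.1 :=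
    interior_mem (hF.isClosed_preimage _)
      ((hf z₀).eventually (ge_mem_nhds (by linarith)))
  filter_upwards [(isOpen_basic (hF.isOpen_preimage (f z₀ - ε / 2))).mem_nhds h1,
    (isOpen_basic isOpen_interior).mem_nhds h2] with z hz1 hz2
  have h3 : f z₀ - ε / 2 ≤ f z :=
    ge_of_tendsto (hf z) (by filter_upwards [hz1] with x hx using le_of_lt hx)
  have h4 : f z ≤ f z₀ + ε / 2 :=
    le_of_tendsto (hf z) (mem_of_superset hz2 interior_subset)
  rw [Real.dist_eq, abs_lt]
  constructor <;> linarith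

variable [CompactSpace X]

/-- The point to which a generic ultrafilter on a compact space converges. -/
noncomputable def limit (z : GenericUltrafilter X) : X := z.1.lim

theorem le_nhds_limit (z : GenericUltrafilter X) : (z.1 : Filter X) ≤ 𝓝 z.limit :=
  z.1.le_nhds_lim

variable [T2Space X]

theorem limit_eq {z : GenericUltrafilter X} {x : X} (h : (z.1 : Filter X) ≤ 𝓝 x) : z.limit = x :=
  tendsto_nhds_unique (f := id) (z.le_nhds_limit) h

theorem continuous_limit : Continuous (limit : GenericUltrafilter X → X) := by
  refine continuous_iff_continuousAt.2 fun z₀ => ?_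
  refine (closed_nhds_basis z₀.limit).tendsto_right_iff.2 ?_
  rintro C ⟨hC, hCc⟩
  have h : interior C ∈ z₀.1 := interior_mem hCc (z₀.le_nhds_limit hC)
  filter_upwards [(isOpen_basic isOpen_interior).mem_nhds h] with z hz
  exact hCc.mem_of_tendsto (f := id) (b := (z.1 : Filter X)) z.le_nhds_limit
    (mem_of_superset hz interior_subset)

end Space

section Action

variable {G : Type u} [Group G] {X : Type v} [TopologicalSpace X] [MulAction G X]
  [ContinuousConstSMul G X]

instance : MulAction G (GenericUltrafilter X) where
  smul g z := ⟨z.1.map (g • ·), fun U hU hUd => z.2 _ (hU.preimage (continuous_const_smul g))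
    (hUd.preimage (isOpenMap_smul g))⟩
  one_smul z := Subtype.ext (by
    change z.1.map (fun x => (1 : G) • x) = z.1
    simp only [one_smul]
    exact Ultrafilter.map_id' z.1)
  mul_smul g h z := Subtype.ext (by
    change z.1.map (fun x => (g * h) • x) = (z.1.map (h • ·)).map (g • ·)
    simp only [mul_smul]
    rw [Ultrafilter.map_map]
    rfl)

theorem coe_smul (g : G) (z : GenericUltrafilter X) :
    ((g • z).1 : Filter X) = (z.1 : Filter X).map (g • ·) :=
  rfl

instance : ContinuousConstSMul G (GenericUltrafilter X) where
  continuous_const_smul g := by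
    refine continuous_generateFrom_iff.2 ?_
    rintro _ ⟨U, hU, rfl⟩
    exact isOpen_basic (hU.preimage (continuous_const_smul g))

/-- For irreducibility: an ultrafilter converging to a point of an open `U` contains `U`, so the
basic set of `U` contains the fiber over each point of `U`. -/
theorem isIrreducibleExtension_limit [CompactSpace X] [T2Space X] :
    IsIrreducibleExtension G (limit : GenericUltrafilter X → X) where
  continuous := continuous_limit
  map_smul g z := limit_eq (by
    rw [coe_smul]
    exact ((continuous_const_smul g).tendsto z.limit).mono_left z.le_nhds_limit)
  surjective x := by
    obtain ⟨z, hz, -⟩ := exists_of_mem_closure isOpen_univ (subset_closure (mem_univ x))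
    exact ⟨z, limit_eq hz⟩
  irreducible S hS hne := by
    obtain ⟨z, hz⟩ := hne
    obtain ⟨_, ⟨U, hU, rfl⟩, hzU, hUS⟩ := isTopologicalBasis.exists_subset_of_mem_open hz hS
    obtain ⟨x, hx⟩ := z.1.nonempty_of_mem hzU
    refine ⟨x, fun w hw => hUS ?_⟩
    have hw : w.limit = x := hw
    exact w.le_nhds_limit (hw ▸ hU.mem_nhds hx)

end Action

end GenericUltrafilter

/-! ### Uniformly separated open sets -/

section Separation

variable {G : Type u} [Group G] [TopologicalSpace G] [IsTopologicalGroup G]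

/-- In a locally compact group there are bump functions at the identity which are uniformly
continuous with respect to left multiplication. -/
theorem exists_bump_mul_left [LocallyCompactSpace G] {V : Set G} (hV : V ∈ 𝓝 (1 : G)) :
    ∃ φ : G → ℝ, φ 1 = 1 ∧ (∀ h ∉ V, φ h = 0) ∧ (∀ h, φ h ∈ Icc (0 : ℝ) 1) ∧
      ∀ ε > 0, ∀ᶠ g in 𝓝 (1 : G), ∀ h, |φ (g * h) - φ h| ≤ ε := by
  obtain ⟨φ, h1, h0, hc, hI⟩ := exists_continuous_one_zero_of_isCompact
    (isCompact_singleton (x := (1 : G))) (isOpen_interior (s := V)).isClosed_compl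
    (disjoint_compl_right_iff_subset.2 (singleton_subset_iff.2 (mem_interior_iff_mem_nhds.2 hV)))
  refine ⟨φ, h1 rfl, fun h hh => h0 fun hi => hh (interior_subset hi), hI, fun ε hε => ?_⟩
  obtain ⟨T, hT, hT1⟩ := exists_compact_mem_nhds (1 : G)
  -- Outside this compact set both `φ h` and `φ (g * h)` vanish for all `g ∈ T`.
  have hC : IsCompact (tsupport φ ∪ T⁻¹ * tsupport φ) := hc.isCompact.union (hT.inv.mul hc.isCompact)
  have hev : ∀ᶠ g in 𝓝 (1 : G), ∀ h ∈ tsupport φ ∪ T⁻¹ * tsupport φ, |φ (g * h) - φ h| < ε := by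
    refine hC.eventually_forall_of_forall_eventually fun h _ => ?_
    have hcont : Continuous fun p : G × G => |φ (p.1 * p.2) - φ p.2| := by fun_prop
    have := hcont.tendsto ((1 : G), h)
    simp only [one_mul, sub_self, abs_zero] at this
    exact this.eventually (gt_mem_nhds hε)
  filter_upwards [hev, hT1] with g hg hgT h
  by_cases hh : h ∈ tsupport φ ∪ T⁻¹ * tsupport φ
  · exact (hg h hh).le
  · have h2 : φ h = 0 := image_eq_zero_of_notMem_tsupport fun h' => hh (Or.inl h')
    have h3 : φ (g * h) = 0 := image_eq_zero_of_notMem_tsupport fun h' =>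
      hh (Or.inr ⟨g⁻¹, inv_mem_inv.2 hgT, g * h, h', by simp⟩)
    simpa [h2, h3] using hε.le

variable {X : Type v} [TopologicalSpace X] [MulAction G X]

/-- A bounded `G`-continuous lower semicontinuous function on a Gleason complete flow has the same
limit along all generic ultrafilters converging to a given point. -/
theorem IsGleasonComplete.tendsto_unique [CompactSpace X] [T2Space X] [ContinuousSMul G X]
    (hX : IsGleasonComplete G X) {F : X → ℝ} (hF : LowerSemicontinuous F)
    (hI : ∀ x, F x ∈ Icc (0 : ℝ) 1)
    (hFG : ∀ ε > 0, ∀ᶠ g in 𝓝 (1 : G), ∀ x, |F (g • x) - F x| ≤ ε)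
    {z₁ z₂ : GenericUltrafilter X} {x : X} (h₁ : (z₁.1 : Filter X) ≤ 𝓝 x)
    (h₂ : (z₂.1 : Filter X) ≤ 𝓝 x) {a b : ℝ} (ha : Tendsto F z₁.1 (𝓝 a))
    (hb : Tendsto F z₂.1 (𝓝 b)) : a = b := by
  have hlim : ∀ z : GenericUltrafilter X, ∃ c, Tendsto F z.1 (𝓝 c) := by
    intro z
    obtain ⟨c, -, hc⟩ := (isCompact_Icc (a := (0 : ℝ)) (b := 1)).ultrafilter_le_nhds (z.1.map F)
      (by
        rw [le_principal_iff]
        exact univ_mem' (f := (z.1 : Filter X)) hI)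
    exact ⟨c, hc⟩
  choose f hf using hlim
  have hfc := GenericUltrafilter.continuous_of_tendsto hF hf
  have hfG : ∀ ε > 0, ∀ᶠ g in 𝓝 (1 : G), ∀ z, |f (g • z) - f z| ≤ ε := by
    intro ε hε
    filter_upwards [hFG ε hε] with g hg z
    have h1 : Tendsto (fun x => F (g • x)) z.1 (𝓝 (f (g • z))) := tendsto_map'_iff.1 (hf (g • z))
    exact le_of_tendsto (h1.sub (hf z)).abs (Eventually.of_forall hg)
  have := hX.eq_of_map_eq GenericUltrafilter.isIrreducibleExtension_limit hfc hfG
    ((GenericUltrafilter.limit_eq h₁).trans (GenericUltrafilter.limit_eq h₂).symm)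
  rw [tendsto_nhds_unique ha (hf z₁), tendsto_nhds_unique hb (hf z₂), this]

/-- In a Gleason complete flow of a locally compact group, open sets that are separated uniformly
with respect to the action have disjoint closures. -/
theorem IsGleasonComplete.disjoint_closure [LocallyCompactSpace G] [CompactSpace X] [T2Space X]
    [ContinuousSMul G X] (hX : IsGleasonComplete G X) {O₁ O₂ : Set X} (h₁ : IsOpen O₁)
    (h₂ : IsOpen O₂) {V : Set G} (hV : V ∈ 𝓝 (1 : G)) (hd : Disjoint (V • O₁) O₂) :
    Disjoint (closure O₁) (closure O₂) := by
  obtain ⟨φ, hφ1, hφV, hφI, hφ⟩ := exists_bump_mul_left hV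
  -- The supremum `F x` is that of `φ h` over the `h` with `x ∈ h • O₁`. Moving `x` by `g` reindexes
  -- `h` to `g * h`, so the uniform estimate for `φ` passes to `F`.
  let T : X → G → ℝ := fun x h => O₁.indicator (fun _ => φ h) (h⁻¹ • x)
  have hT0 : ∀ x h, 0 ≤ T x h := fun x h => indicator_nonneg (fun _ _ => (hφI h).1) _
  have hT1 : ∀ x h, T x h ≤ 1 := fun x h =>
    indicator_le' (f := fun _ => φ h) (g := fun _ => (1 : ℝ)) (fun _ _ => (hφI h).2)
      (fun _ _ => zero_le_one) _
  have hbdd : ∀ x, BddAbove (range (T x)) := fun x => ⟨1, forall_mem_range.2 (hT1 x)⟩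
  let F : X → ℝ := fun x => ⨆ h, T x h
  have hle : ∀ x h, T x h ≤ F x := fun x h => le_ciSup (hbdd x) h
  have hI : ∀ x, F x ∈ Icc (0 : ℝ) 1 := fun x =>
    ⟨(hT0 x 1).trans (hle x 1), ciSup_le (hT1 x)⟩
  have hF : LowerSemicontinuous F := by
    refine lowerSemicontinuous_ciSup hbdd fun h => ?_
    exact (h₁.lowerSemicontinuous_indicator (hφI h).1).comp (continuous_const_smul h⁻¹)
  have hTg : ∀ (g : G) (x : X) (h : G),
      T (g • x) (g * h) = O₁.indicator (fun _ => φ (g * h)) (h⁻¹ • x) := by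
    intro g x h
    simp only [T, smul_smul, mul_inv_rev, inv_mul_cancel_right]
  have hFG : ∀ ε > 0, ∀ᶠ g in 𝓝 (1 : G), ∀ x, |F (g • x) - F x| ≤ ε := by
    intro ε hε
    filter_upwards [hφ ε hε] with g hg x
    have hT : ∀ h, |T (g • x) (g * h) - T x h| ≤ ε := by
      intro h
      rw [hTg]
      by_cases hx : h⁻¹ • x ∈ O₁
      · simpa [T, hx] using hg h
      · simpa [T, hx] using hε.le
    rw [abs_le]
    constructor
    · have : F x ≤ F (g • x) + ε := ciSup_le fun h => by
        have := (abs_le.1 (hT h)).1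
        have := hle (g • x) (g * h)
        linarith
      linarith
    · have : F (g • x) ≤ F x + ε := ciSup_le fun h => by
        have h3 := (abs_le.1 (hT (g⁻¹ * h))).2
        rw [mul_inv_cancel_left] at h3
        have := hle x (g⁻¹ * h)
        linarith
      linarith
  have hF1 : ∀ x ∈ O₁, F x = 1 := fun x hx =>
    le_antisymm (hI x).2 (by simpa [T, hx, hφ1] using hle x 1)
  have hF0 : ∀ x ∈ O₂, F x = 0 := by
    refine fun x hx => le_antisymm (ciSup_le fun h => ?_) (hI x).1
    refine indicator_apply_le' (fun hh => (hφV h fun hhV => ?_).le) fun _ => le_rfl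
    exact disjoint_left.1 hd ⟨h, hhV, _, hh, smul_inv_smul h x⟩ hx
  refine disjoint_left.2 fun x hx₁ hx₂ => ?_
  obtain ⟨z₁, hz₁, hO₁⟩ := GenericUltrafilter.exists_of_mem_closure h₁ hx₁
  obtain ⟨z₂, hz₂, hO₂⟩ := GenericUltrafilter.exists_of_mem_closure h₂ hx₂
  have e₁ : Tendsto F z₁.1 (𝓝 1) :=
    tendsto_const_nhds.congr' (by filter_upwards [hO₁] with y hy using (hF1 y hy).symm)
  have e₂ : Tendsto F z₂.1 (𝓝 0) :=
    tendsto_const_nhds.congr' (by filter_upwards [hO₂] with y hy using (hF0 y hy).symm)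
  exact one_ne_zero (hX.tendsto_unique hF hI hFG hz₁ hz₂ e₁ e₂)

end Separation

/-! ### Finite colorings by maximal families -/

section Coloring

variable {G : Type u} [Group G] {X : Type v} [TopologicalSpace X] [MulAction G X]

/-- There are maximal families of open sets `O i` such that no element of `R i j` moves a point of
`O i` into `O j`. -/
theorem exists_maximal_isOpen_family {ι : Type*} (R : ι → ι → Set G) :
    ∃ O : ι → Set X, Maximal (· ∈ {O : ι → Set X | (∀ i, IsOpen (O i)) ∧
      ∀ i j, ∀ g ∈ R i j, ∀ x ∈ O i, g • x ∉ O j}) O := by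
  refine zorn_le₀ _ fun c hc hchain => ⟨fun i => ⋃ O ∈ c, O i, ⟨fun i => ?_, ?_⟩, ?_⟩
  · exact isOpen_biUnion fun O hO => (hc hO).1 i
  · intro i j g hg x hx hgx
    obtain ⟨O, hO, hx⟩ := mem_iUnion₂.1 hx
    obtain ⟨O', hO', hgx⟩ := mem_iUnion₂.1 hgx
    obtain h | h := hchain.total hO hO'
    · exact (hc hO').2 i j g hg x (h i hx) hgx
    · exact (hc hO).2 i j g hg x hx (h j hgx)
  · exact fun O hO i => subset_biUnion_of_mem (u := fun O : ι → Set X => O i) hO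

variable [TopologicalSpace G]

/-- The set of points fixed by no element of a compact set is open. -/
theorem isOpen_setOf_forall_smul_ne [T2Space X] [ContinuousSMul G X] {A : Set G}
    (hA : IsCompact A) : IsOpen {x : X | ∀ a ∈ A, a • x ≠ x} := by
  refine isOpen_iff_mem_nhds.2 fun x hx => ?_
  refine hA.eventually_forall_of_forall_eventually fun a ha => ?_
  have : IsOpen {p : X × G | p.2 • p.1 ≠ p.1} :=
    isOpen_ne_fun (by fun_prop) (by fun_prop)
  exact this.mem_nhds (hx a ha)

/-- A point fixed by no element of a compact set `A` has small neighbourhoods which are disjoint from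
their translates by elements of `A`. -/
theorem exists_isOpen_forall_smul_notMem [T2Space X] [ContinuousSMul G X] {A : Set G}
    (hA : IsCompact A) {x : X} (hx : ∀ a ∈ A, a • x ≠ x) {N : Set X} (hN : N ∈ 𝓝 x) :
    ∃ M ⊆ N, IsOpen M ∧ x ∈ M ∧ ∀ a ∈ A, ∀ y ∈ M, a • y ∉ M := by
  have h : ∀ᶠ p : X × X in 𝓝 (x, x), ∀ a ∈ A, a • p.1 ≠ p.2 := by
    refine hA.eventually_forall_of_forall_eventually fun a ha => ?_
    have : IsOpen {p : (X × X) × G | p.2 • p.1.1 ≠ p.1.2} :=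
      isOpen_ne_fun (by fun_prop) (by fun_prop)
    exact this.mem_nhds (hx a ha)
  rw [nhds_prod_eq, eventually_prod_self_iff'] at h
  obtain ⟨M, hM, hMA⟩ := h
  obtain ⟨M', hM', hM'o, hxM'⟩ := mem_nhds_iff.1 (inter_mem hM hN)
  exact ⟨M', fun y hy => (hM' hy).2, hM'o, hxM',
    fun a ha y hy hay => hMA _ (hM' hy).1 _ (hM' hay).1 a ha rfl⟩

/-- If no element of the compact set `A` fixes a point of the open set `W`, then `W` is covered, up to
closure, by finitely many `D`-thickenings of open sets disjoint from their `A`-translates. -/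
theorem exists_finite_coloring [IsTopologicalGroup G] [T2Space X] [ContinuousSMul G X]
    {A D : Set G} (hA : IsCompact A) (hD : D ∈ 𝓝 (1 : G)) {W : Set X} (hW : IsOpen W)
    (hWA : ∀ x ∈ W, ∀ a ∈ A, a • x ≠ x) :
    ∃ (n : ℕ) (O : Fin n → Set X), (∀ i, IsOpen (O i)) ∧ (∀ i, ∀ a ∈ A, ∀ x ∈ O i, a • x ∉ O i) ∧
      W ⊆ closure (⋃ i, D • O i) := by
  obtain ⟨E, hE, hED⟩ := exists_nhds_split_inv (inter_mem hD (inv_mem_nhds_one G hD))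
  -- This sorts `A ∪ A⁻¹` into `t.card` classes; for `b`, `b'` in one class, `b'⁻¹ * b ∈ D ∩ D⁻¹`.
  -- One more color than classes forces a collision.
  obtain ⟨t, ht⟩ := compact_covered_by_mul_left_translates (hA.union hA.inv) (V := E⁻¹)
    ⟨1, mem_interior_iff_mem_nhds.2 (inv_mem_nhds_one G hE)⟩
  -- By symmetry of `D ∩ D⁻¹`, a point outside all `D • O j` violates no constraint between
  -- different colors.
  let R : Fin (t.card + 1) → Fin (t.card + 1) → Set G := fun i j => if i = j then A else D ∩ D⁻¹
  obtain ⟨O, ⟨hO, hOR⟩, hmax⟩ := exists_maximal_isOpen_family (X := X) R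
  refine ⟨_, O, hO, fun i a ha => hOR i i a (by simpa [R] using ha), ?_⟩
  by_contra hcon
  obtain ⟨x, hxW, hx⟩ := not_subset.1 hcon
  let W' := W \ closure (⋃ i, D • O i)
  have hW' : IsOpen W' := hW.sdiff isClosed_closure
  have hDO : ∀ y ∈ W', ∀ i, ∀ d ∈ D, ∀ o ∈ O i, d • o ≠ y := by
    rintro y hy i d hd o ho rfl
    exact hy.2 (subset_closure (mem_iUnion.2 ⟨i, smul_mem_smul hd ho⟩))
  -- Otherwise a small open `M` around `y` could be added to color `i`; maximality then gives `y ∈ O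
  -- i ⊆ D • O i`, which `W'` avoids.
  have hdense : ∀ i, W' ⊆ closure ((A ∪ A⁻¹) • O i) := by
    intro i y hy
    refine mem_closure_iff_nhds.2 fun N hN => ?_
    obtain ⟨M, hMN, hM, hyM, hMA⟩ :=
      exists_isOpen_forall_smul_notMem hA (hWA y hy.1) (inter_mem hN (hW'.mem_nhds hy))
    by_contra hemp
    have hMO : ∀ b ∈ A ∪ A⁻¹, ∀ o ∈ O i, b • o ∉ M := fun b hb o ho hbo =>
      hemp ⟨b • o, (hMN hbo).1, smul_mem_smul hb ho⟩
    have hMW : ∀ m ∈ M, m ∈ W' := fun m hm => (hMN hm).2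
    let O' : Fin (t.card + 1) → Set X := fun j => O j ∪ {m | j = i ∧ m ∈ M}
    have hO' : (∀ j, IsOpen (O' j)) ∧ ∀ j k, ∀ g ∈ R j k, ∀ m ∈ O' j, g • m ∉ O' k := by
      refine ⟨fun j => (hO j).union ?_, ?_⟩
      · by_cases hj : j = i
        · simpa [hj] using hM
        · simp [hj]
      · rintro j k g hg m (hm | ⟨rfl, hm⟩) (hgm | ⟨rfl, hgm⟩)
        · exact hOR j k g hg m hm hgm
        · by_cases hjk : j = k
          · subst hjk
            exact hMO g (Or.inl (by simpa [R] using hg)) m hm hgm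
          · simp only [R, if_neg hjk] at hg
            exact hDO _ (hMW _ hgm) j g hg.1 m hm rfl
        · by_cases hjk : j = k
          · subst hjk
            refine hMO g⁻¹ (Or.inr ?_) _ hgm ((inv_smul_smul g m).symm ▸ hm)
            simpa [R] using hg
          · simp only [R, if_neg hjk] at hg
            exact hDO _ (hMW _ hm) k g⁻¹ hg.2 _ hgm (inv_smul_smul g m)
        · exact hMA g (by simpa [R] using hg) m hm hgm
    have hyO : y ∈ O i := hmax hO' (fun j => subset_union_left) i (Or.inr ⟨rfl, hyM⟩)
    exact hDO y hy i 1 (mem_of_mem_nhds hD) y hyO (one_smul G y)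
  have hP : ∀ i, IsOpen ((A ∪ A⁻¹) • O i) := fun i => (hO i).smul_left
  have hne : ∀ s : Finset (Fin (t.card + 1)), (W' ∩ ⋂ i ∈ s, (A ∪ A⁻¹) • O i).Nonempty := by
    intro s
    induction s using Finset.induction_on with
    | empty => exact ⟨x, ⟨hxW, hx⟩, by simp⟩
    | insert i s _ ih =>
      obtain ⟨y, hy⟩ := ih
      obtain ⟨w, hw, hwi⟩ := mem_closure_iff.1 (hdense i hy.1) _
        (hW'.inter (isOpen_biInter_finset fun j _ => hP j)) hy
      refine ⟨w, hw.1, ?_⟩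
      rw [Finset.set_biInter_insert]
      exact ⟨hwi, hw.2⟩
  obtain ⟨y, -, hy⟩ := hne Finset.univ
  have hy' : ∀ i, ∃ b ∈ A ∪ A⁻¹, ∃ o ∈ O i, b • o = y := fun i =>
    mem_smul.1 (mem_iInter₂.1 hy i (Finset.mem_univ i))
  choose b hb o ho hbo using hy'
  have hcov : ∀ i, ∃ c : t, (c * b i)⁻¹ ∈ E := fun i => by
    obtain ⟨c, hc, hcb⟩ := mem_iUnion₂.1 (ht (hb i))
    exact ⟨⟨c, hc⟩, hcb⟩
  choose c hc using hcov
  -- For two colors in one class, `(b j)⁻¹ * b i` lies in `R i j` yet moves `o i` to `o j`.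
  obtain ⟨i, j, hij, hcij⟩ := Fintype.exists_ne_map_eq_of_card_lt c (by simp)
  have hD' := hED _ (hc j) _ (hc i)
  rw [hcij, show ((c j : G) * b j)⁻¹ / (c j * b i)⁻¹ = (b j)⁻¹ * b i by
    simp [div_eq_mul_inv, mul_assoc]] at hD'
  refine hOR i j _ (by simpa only [R, if_neg hij] using hD') (o i) (ho i) ?_
  rw [mul_smul, hbo i, ← hbo j, inv_smul_smul]
  exact ho j

end Coloring

/-! ### Continuity of the stabilizer map -/

/-- In a Gleason complete flow of a locally compact group, an element `g` of the stabilizer of `x`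
can be approximated by elements of the stabilizers of all points near `x`. -/
theorem IsGleasonComplete.eventually_exists_smul_eq {G : Type u} [Group G] [TopologicalSpace G]
    [IsTopologicalGroup G] [LocallyCompactSpace G] {X : Type v} [TopologicalSpace X]
    [CompactSpace X] [T2Space X] [MulAction G X] [ContinuousSMul G X] (hX : IsGleasonComplete G X)
    {x : X} {g : G} (hg : g • x = x) {U : Set G} (hU : U ∈ 𝓝 g) :
    ∀ᶠ y in 𝓝 x, ∃ a ∈ U, a • y = y := by
  obtain ⟨A, hAg, hAU, hA⟩ := local_compact_nhds hU
  let W := {y : X | ∀ a ∈ A, a • y ≠ y}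
  have hW : IsOpen W := isOpen_setOf_forall_smul_ne hA
  by_cases hx : x ∈ closure W
  · exfalso
    -- A common point `v • d • o = g • d' • o'` would give `(d⁻¹ * v⁻¹ * g * d') • o' = o`; this
    -- element must lie in `A` for the color `O i` to forbid it.
    have hcont : Continuous fun p : G × G × G => p.1⁻¹ * p.2.1⁻¹ * g * p.2.2 := by fun_prop
    have hev : ∀ᶠ p : G × G × G in 𝓝 (1, 1, 1), p.1⁻¹ * p.2.1⁻¹ * g * p.2.2 ∈ A := by
      have := hcont.tendsto (1, 1, 1)
      simp only [inv_one, one_mul, mul_one] at this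
      exact this hAg
    rw [nhds_prod_eq, nhds_prod_eq] at hev
    obtain ⟨D₁, hD₁, S, hS, hDS⟩ := mem_prod_iff.1 hev
    obtain ⟨V, hV, D₂, hD₂, hVD⟩ := mem_prod_iff.1 hS
    obtain ⟨n, O, hO, hOA, hcov⟩ :=
      exists_finite_coloring hA (inter_mem hD₁ hD₂) hW fun _ hy => hy
    have hx' := closure_minimal hcov isClosed_closure hx
    rw [closure_iUnion_of_finite] at hx'
    obtain ⟨i, hi⟩ := mem_iUnion.1 hx'
    have hopen : IsOpen ((D₁ ∩ D₂) • O i) := (hO i).smul_left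
    refine disjoint_left.1 (hX.disjoint_closure hopen (hopen.smul g) hV ?_) hi ?_
    · rw [disjoint_left]
      rintro _ ⟨v, hv, _, ⟨d, hd, o, ho, rfl⟩, rfl⟩ ⟨_, ⟨d', hd', o', ho', rfl⟩, h⟩
      have hmem : d⁻¹ * v⁻¹ * g * d' ∈ A :=
        hDS (show (d, v, d') ∈ D₁ ×ˢ S from ⟨hd.1, hVD ⟨hv, hd'.2⟩⟩)
      refine hOA i _ hmem o' ho' ?_
      have h : g • d' • o' = v • d • o := h
      rw [mul_smul, mul_smul, mul_smul, h, inv_smul_smul, inv_smul_smul]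
      exact ho
    · have := map_mem_closure (continuous_const_smul g) hi
        (t := g • ((D₁ ∩ D₂) • O i)) fun y hy => smul_mem_smul_set hy
      rwa [hg] at this
  · filter_upwards [isClosed_closure.isOpen_compl.mem_nhds hx] with y hy
    by_contra! h
    exact hy (subset_closure fun a ha => h a (hAU ha))

theorem theorem4p1 {G : Type u} [Group G] [TopologicalSpace G] [IsTopologicalGroup G]
    [LocallyCompactSpace G] {X : Type v} [TopologicalSpace X] [CompactSpace X] [T2Space X]
    [MulAction G X] [ContinuousSMul G X] (hX : IsGleasonComplete G X) :
    Continuous (stabilizerMap G X) := by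
  refine continuous_induced_rng.2 (continuous_generateFrom_iff.2 ?_)
  rintro _ (⟨K, hK, rfl⟩ | ⟨U, hU, rfl⟩)
  · convert isOpen_setOf_forall_smul_ne (X := X) hK using 1
    ext x
    change {g : G | g • x = x} ∩ K = ∅ ↔ _
    rw [eq_empty_iff_forall_notMem]
    exact ⟨fun h a ha hax => h a ⟨hax, ha⟩, fun h a ha => h a ha.2 ha.1⟩
  · refine isOpen_iff_mem_nhds.2 ?_
    rintro x ⟨g, hgx, hgU⟩
    filter_upwards [hX.eventually_exists_smul_eq hgx (hU.mem_nhds hgU)] with y ⟨a, haU, ha⟩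
    exact ⟨a, ha, haU⟩
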